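/- For integers $a,b,m\ge 1$, an $(a,b,m)$-copartition is a triple of integer partitions $(\gamma,\rho,\sigma)$ such that each part of $\gamma$ is at least $a$ and congruent to $a \pmod m$, each part of $\sigma$ is at least $b$ and congruent to $b \pmod m$, and $\rho$ has the same number of parts as $\sigma$, each of size equal to $m$ times the number of parts of $\gamma$ (so $\rho=\emptyset$ if $\gamma$ or $\sigma$ is empty). Its size is the sum of all the parts of $\gamma$, $\rho$ and $\sigma$, and $\mathrm{cp}_{a,b,m}(n)$ denotes the number of $(a,b,m)$-copartitions of size $n$. **Corollary.** (1) For $r = 3, 14, 36, 47, 58, 69, 80, 91, 102, 113$, we have $\mathrm{cp}_{3,1,4}(121k+r)\equiv 0 \pmod 2$ for every nonnegative integer $k$. (2) For $r = 9, 31, 42, 53, 64, 75, 86, 97, 108, 119$, we have $\mathrm{cp}_{5,1,6}(121k+r)\equiv 0 \pmod 2$ for every nonnegative integer $k$. -/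

import Mathlib

/-- An `(a,b,m)`-copartition `(γ, ρ, σ)` (ground, rectangle, sky). Partitions are finite multisets
of positive integers. Every part of the ground is at least `a` and congruent to `a` modulo `m`;
every part of the sky is at least `b` and congruent to `b` modulo `m`; the rectangle has as many
parts as the sky, each equal to `m` times the number of parts of the ground (so it is the empty
partition when the ground is empty, parts of size zero being dropped). -/
@[ext]
structure Copartition (a b m : ℕ) where
  ground : Multiset ℕ
  rect : Multiset ℕ
  sky : Multiset ℕ
  ground_pos : ∀ x ∈ ground, 0 < x
  sky_pos : ∀ x ∈ sky, 0 < x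
  ground_parts : ∀ x ∈ ground, a ≤ x ∧ x ≡ a [MOD m]
  sky_parts : ∀ x ∈ sky, b ≤ x ∧ x ≡ b [MOD m]
  rect_eq : rect =
    (Multiset.replicate (Multiset.card sky) (m * Multiset.card ground)).filter (fun x => x ≠ 0)

namespace Copartition

/-- The size of a copartition: the sum of all parts of its three partitions. -/
def size {a b m : ℕ} (c : Copartition a b m) : ℕ :=
  c.ground.sum + c.rect.sum + c.sky.sum

theorem finite_multiset_sum_le (n : ℕ) :
    {s : Multiset ℕ | (∀ x ∈ s, 0 < x) ∧ s.sum ≤ n}.Finite := by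
  refine (Set.finite_Iic (n • (Multiset.range (n + 1)))).subset ?_
  rintro s ⟨hpos, hsum⟩
  rw [Set.mem_Iic, Multiset.le_iff_count]
  intro x
  by_cases hx : x ∈ s
  · have h1 : x ≤ s.sum := Multiset.le_sum_of_mem hx
    have h2 : Multiset.card s • 1 ≤ s.sum := Multiset.card_nsmul_le_sum (fun y hy => hpos y hy)
    have h3 : Multiset.count x s ≤ Multiset.card s := Multiset.count_le_card x s
    have h4 : 1 ≤ Multiset.count x (Multiset.range (n + 1)) := by
      rw [Multiset.one_le_count_iff_mem, Multiset.mem_range]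
      omega
    rw [Multiset.count_nsmul]
    simp only [smul_eq_mul, mul_one] at h2
    nlinarith
  · rw [Multiset.count_eq_zero_of_notMem hx]
    exact Nat.zero_le _

/-- There are only finitely many `(a,b,m)`-copartitions of a given size, so that counting them by
`Nat.card` is meaningful. -/
instance finite_size_eq (a b m n : ℕ) : Finite {c : Copartition a b m // c.size = n} := by
  have hfin := (finite_multiset_sum_le n).prod (finite_multiset_sum_le n)
  have := hfin.to_subtype
  refine Finite.of_injective
    (fun c : {c : Copartition a b m // c.size = n} =>
      (⟨(c.1.ground, c.1.sky), by
        have h := c.2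
        unfold size at h
        exact ⟨⟨c.1.ground_pos, by dsimp only; omega⟩, ⟨c.1.sky_pos, by dsimp only; omega⟩⟩⟩ :
        ({s : Multiset ℕ | (∀ x ∈ s, 0 < x) ∧ s.sum ≤ n} ×ˢ
          {s : Multiset ℕ | (∀ x ∈ s, 0 < x) ∧ s.sum ≤ n} : Set (Multiset ℕ × Multiset ℕ)))) ?_
  rintro ⟨c, hc⟩ ⟨d, hd⟩ h
  have h' : c.ground = d.ground ∧ c.sky = d.sky := Prod.mk.inj (congrArg Subtype.val h)
  apply Subtype.ext
  exact Copartition.ext h'.1 (by rw [c.rect_eq, d.rect_eq, h'.1, h'.2]) h'.2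

end Copartition

/-- `cp a b m n` is the number of `(a,b,m)`-copartitions of size `n`. -/
noncomputable def cp (a b m n : ℕ) : ℕ :=
  Nat.card {c : Copartition a b m // c.size = n}

open PowerSeries

/-! ### Bijections on copartitions -/

namespace Copartition

variable {a b m : ℕ}

/-! Write (q^s; q^m) for the product `qProd s m`. The generating function of copartitions is
(q^(a+b); q^m) / ((q^a; q^m)(q^b; q^m)) (`cpSeries_mul_qProd`, modulo 2). It follows from a
recurrence given by whether `a` is a part of the ground. Modulo 2 squaring doubles exponents, and
the quotient collapses to `qProd 1 1 * qProd d d`, with d = 4 for (3,1,4) and d = 3 for (5,1,6). By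
the pentagonal number theorem, a nonzero coefficient at n forces 24n + 1 + d = x² + d y². As -3 and
-4 are nonresidues modulo 11, 11 divides this form only if 121 does. The listed r make 24n + 1 + d
divisible by 11 but not by 121. -/

theorem sum_filter_ne_zero (s : Multiset ℕ) : (s.filter (fun x => x ≠ 0)).sum = s.sum := by
  induction s using Multiset.induction with
  | empty => simp
  | cons x s ih => by_cases hx : x = 0 <;> simp_all

theorem size_eq (c : Copartition a b m) :
    c.size = c.ground.sum + m * (Multiset.card c.ground * Multiset.card c.sky) + c.sky.sum := by
  rw [size, c.rect_eq, sum_filter_ne_zero, Multiset.sum_replicate, smul_eq_mul]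
  ring

theorem ext_ground_sky {c d : Copartition a b m} (hg : c.ground = d.ground) (hs : c.sky = d.sky) :
    c = d :=
  Copartition.ext hg (by rw [c.rect_eq, d.rect_eq, hg, hs]) hs

/-- The copartition with given ground and sky. -/
def ofGroundSky (ha : 0 < a) (hb : 0 < b) (g s : Multiset ℕ)
    (hg : ∀ x ∈ g, a ≤ x ∧ x ≡ a [MOD m]) (hs : ∀ x ∈ s, b ≤ x ∧ x ≡ b [MOD m]) :
    Copartition a b m where
  ground := g
  rect := (Multiset.replicate (Multiset.card s) (m * Multiset.card g)).filter (fun x => x ≠ 0)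
  sky := s
  ground_pos x hx := ha.trans_le (hg x hx).1
  sky_pos x hx := hb.trans_le (hs x hx).1
  ground_parts := hg
  sky_parts := hs
  rect_eq := rfl

/-- Exchanging ground and sky. -/
def swap (ha : 0 < a) (hb : 0 < b) : Copartition a b m ≃ Copartition b a m where
  toFun c := ofGroundSky hb ha c.sky c.ground c.sky_parts c.ground_parts
  invFun c := ofGroundSky ha hb c.sky c.ground c.sky_parts c.ground_parts
  left_inv _ := ext_ground_sky rfl rfl
  right_inv _ := ext_ground_sky rfl rfl

theorem size_swap (ha : 0 < a) (hb : 0 < b) (c : Copartition a b m) :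
    (swap ha hb c).size = c.size := by
  simp only [size_eq, swap, ofGroundSky, Equiv.coe_fn_mk]
  ring

theorem add_modulus_le {x : ℕ} (h : a ≤ x ∧ x ≡ a [MOD m]) (hx : x ≠ a) : a + m ≤ x := by
  have h1 : m ∣ x - a := (Nat.modEq_iff_dvd' h.1).1 h.2.symm
  have := Nat.le_of_dvd (by omega) h1
  omega

/-- A copartition whose ground avoids the smallest admissible part `a` is an
`(a + m, b, m)`-copartition. -/
def groundShift (ha : 0 < a) (hb : 0 < b) (hm : 0 < m) :
    {c : Copartition a b m // a ∉ c.ground} ≃ Copartition (a + m) b m where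
  toFun c := ofGroundSky (by omega) hb c.1.ground c.1.sky
    (fun x hx => ⟨add_modulus_le (c.1.ground_parts x hx) (fun h => c.2 (h ▸ hx)),
      (c.1.ground_parts x hx).2.trans (by simp [Nat.ModEq])⟩) c.1.sky_parts
  invFun c := ⟨ofGroundSky ha hb c.ground c.sky
    (fun x hx => ⟨by have := (c.ground_parts x hx).1; omega,
      (c.ground_parts x hx).2.trans (by simp [Nat.ModEq])⟩) c.sky_parts,
    fun h => by have := (c.ground_parts a h).1; omega⟩
  left_inv _ := Subtype.ext (ext_ground_sky rfl rfl)
  right_inv _ := ext_ground_sky rfl rfl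

theorem size_groundShift (ha : 0 < a) (hb : 0 < b) (hm : 0 < m)
    (c : {c : Copartition a b m // a ∉ c.ground}) :
    (groundShift ha hb hm c).size = c.1.size := by
  simp only [size_eq, groundShift, ofGroundSky, Equiv.coe_fn_mk]

/-- Removing one copy of the smallest admissible ground part `a` and adding `m` to every part of
the sky. -/
def groundErase (ha : 0 < a) (hb : 0 < b) :
    {c : Copartition a b m // a ∈ c.ground} ≃ Copartition a (b + m) m where
  toFun c := ofGroundSky ha (by omega) (c.1.ground.erase a) (c.1.sky.map (· + m))
    (fun x hx => c.1.ground_parts x (Multiset.mem_of_mem_erase hx))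
    (fun x hx => by
      obtain ⟨y, hy, rfl⟩ := Multiset.mem_map.1 hx
      exact ⟨Nat.add_le_add_right (c.1.sky_parts y hy).1 m,
        (c.1.sky_parts y hy).2.add_right m⟩)
  invFun c := ⟨ofGroundSky ha hb (a ::ₘ c.ground) (c.sky.map (· - m))
    (fun x hx => by
      rcases Multiset.mem_cons.1 hx with rfl | hx
      · exact ⟨le_rfl, rfl⟩
      · exact c.ground_parts x hx)
    (fun x hx => by
      obtain ⟨y, hy, rfl⟩ := Multiset.mem_map.1 hx
      have h := c.sky_parts y hy
      refine ⟨by omega, Nat.ModEq.add_right_cancel' m ?_⟩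
      rw [Nat.sub_add_cancel (by omega)]
      exact h.2), by simp [ofGroundSky]⟩
  left_inv c := Subtype.ext (ext_ground_sky (by simp [ofGroundSky, c.2]) (by simp [ofGroundSky]))
  right_inv c := ext_ground_sky (by simp [ofGroundSky]) (by
    simp only [ofGroundSky, Multiset.map_map]
    refine (Multiset.map_congr rfl fun x hx => ?_).trans (Multiset.map_id _)
    have := (c.sky_parts x hx).1
    simp only [Function.comp_apply, id]
    omega)

/-- Losing a ground part shortens each rectangle part by `m`; adding `m` to each sky part
compensates. -/
theorem size_groundErase (ha : 0 < a) (hb : 0 < b) (c : {c : Copartition a b m // a ∈ c.ground}) :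
    (groundErase ha hb c).size + a = c.1.size := by
  have h1 := Multiset.sum_erase c.2
  have h2 := Multiset.card_erase_add_one c.2
  simp only [size_eq, groundErase, ofGroundSky, Equiv.coe_fn_mk, Multiset.sum_map_add,
    Multiset.map_id', Multiset.map_const', Multiset.sum_replicate, Multiset.card_map, smul_eq_mul]
  rw [← h1, ← h2]
  ring

theorem le_size_of_ne_zero (c : Copartition a b m) (hc : c.size ≠ 0) : min a b ≤ c.size := by
  rw [size_eq] at *
  rcases c.ground.empty_or_exists_mem with h | ⟨x, hx⟩
  · rcases c.sky.empty_or_exists_mem with h' | ⟨x, hx⟩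
    · simp [h, h'] at hc
    · have := Multiset.le_sum_of_mem hx
      have := (c.sky_parts x hx).1
      omega
  · have := Multiset.le_sum_of_mem hx
    have := (c.ground_parts x hx).1
    omega

theorem eq_zero_of_size_eq_zero {c : Copartition a b m} (hc : c.size = 0) :
    c.ground = 0 ∧ c.sky = 0 := by
  rw [size_eq] at hc
  constructor
  · refine Multiset.eq_zero_of_forall_notMem fun x hx => ?_
    have := Multiset.le_sum_of_mem hx
    have := c.ground_pos x hx
    omega
  · refine Multiset.eq_zero_of_forall_notMem fun x hx => ?_
    have := Multiset.le_sum_of_mem hx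
    have := c.sky_pos x hx
    omega

end Copartition

/-! ### Counting and the recurrence -/

section Counting

variable {a b m : ℕ}

open Copartition

theorem cp_comm (ha : 0 < a) (hb : 0 < b) (n : ℕ) : cp a b m n = cp b a m n :=
  Nat.card_congr ((swap ha hb).subtypeEquiv fun c => by rw [size_swap])

theorem cp_zero (ha : 0 < a) (hb : 0 < b) : cp a b m 0 = 1 := by
  rw [cp, Nat.card_eq_one_iff_unique]
  refine ⟨⟨fun c d => Subtype.ext ?_⟩, ⟨ofGroundSky ha hb 0 0 (by simp) (by simp), ?_⟩⟩
  · have hc := eq_zero_of_size_eq_zero c.2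
    have hd := eq_zero_of_size_eq_zero d.2
    exact ext_ground_sky (hc.1.trans hd.1.symm) (hc.2.trans hd.2.symm)
  · simp [size_eq, ofGroundSky]

theorem cp_eq_zero_of_lt {n : ℕ} (hn : n ≠ 0) (h : n < min a b) : cp a b m n = 0 := by
  rw [cp, Nat.card_eq_zero]
  refine Or.inl ⟨fun c => ?_⟩
  have := le_size_of_ne_zero c.1 (by rw [c.2]; exact hn)
  rw [c.2] at this
  omega

/-- A subtype splits according to whether a second predicate holds. -/
def subtypeSplit {α : Type*} (p q : α → Prop) [DecidablePred q] :
    {x // p x} ≃ {y : {x // q x} // p y.1} ⊕ {y : {x // ¬ q x} // p y.1} where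
  toFun x := if h : q x.1 then Sum.inl ⟨⟨x.1, h⟩, x.2⟩ else Sum.inr ⟨⟨x.1, h⟩, x.2⟩
  invFun := Sum.elim (fun y => ⟨y.1.1, y.2⟩) (fun y => ⟨y.1.1, y.2⟩)
  left_inv x := by
    by_cases h : q x.1 <;> simp [h]
  right_inv y := by
    rcases y with y | y
    · simp [y.1.2]
    · simp [y.1.2]

theorem cp_recurrence (ha : 0 < a) (hb : 0 < b) (hm : 0 < m) (n : ℕ) :
    cp a b m n = (if a ≤ n then cp a (b + m) m (n - a) else 0) + cp (a + m) b m n := by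
  classical
  have e1 : {c : {c : Copartition a b m // a ∈ c.ground} // c.1.size = n} ≃
      {c : Copartition a (b + m) m // c.size + a = n} :=
    (groundErase ha hb).subtypeEquiv fun c => by rw [size_groundErase]
  have e2 : {c : {c : Copartition a b m // a ∉ c.ground} // c.1.size = n} ≃
      {c : Copartition (a + m) b m // c.size = n} :=
    (groundShift ha hb hm).subtypeEquiv fun c => by rw [size_groundShift]
  have e3 : {c : Copartition a b m // c.size = n} ≃
      {c : {c : Copartition a b m // a ∈ c.ground} // c.1.size = n} ⊕
      {c : {c : Copartition a b m // a ∉ c.ground} // c.1.size = n} :=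
    subtypeSplit _ _
  have e4 := e3.trans (Equiv.sumCongr e1 e2)
  have : Finite {c : Copartition a (b + m) m // c.size + a = n} :=
    Finite.of_injective (fun c => e4.symm (Sum.inl c)) (e4.symm.injective.comp Sum.inl_injective)
  rw [cp, Nat.card_congr e4, Nat.card_sum, cp, cp]
  congr 1
  split_ifs with h
  · exact Nat.card_congr (Equiv.subtypeEquivRight fun c => by omega)
  · rw [Nat.card_eq_zero]
    exact Or.inl ⟨fun c => by have := c.2; omega⟩

end Counting

/-! ### Infinite products modulo 2 -/

open Filter Topology

open PowerSeries.WithPiTopology in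
theorem multipliable_one_sub_X_pow_progression {m : ℕ} (hm : 0 < m) (s : ℕ) :
    Multipliable fun i : ℕ => (1 - X ^ (m * i + s) : (ZMod 2)⟦X⟧) := by
  simp_rw [sub_eq_add_neg]
  apply multipliable_one_add_of_tendsto_order_atTop_nhds_top
  refine ENat.tendsto_nhds_top_iff_natCast_lt.mpr
    fun n => Filter.eventually_atTop.mpr ⟨n + 1, fun i hi => ?_⟩
  rw [order_neg, order_X_pow]
  norm_cast
  nlinarith

open PowerSeries.WithPiTopology in
/-- The infinite product `∏ (1 - X ^ (m * i + s))` over `i ≥ 0`, with coefficients modulo `2`. -/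
noncomputable def qProd (s m : ℕ) : (ZMod 2)⟦X⟧ := ∏' i : ℕ, (1 - X ^ (m * i + s))

section
open PowerSeries.WithPiTopology

theorem tendsto_qProd {m : ℕ} (hm : 0 < m) (s : ℕ) :
    Tendsto (fun N => ∏ i ∈ Finset.range N, (1 - X ^ (m * i + s) : (ZMod 2)⟦X⟧)) atTop
      (𝓝 (qProd s m)) :=
  (multipliable_one_sub_X_pow_progression hm s).hasProd.tendsto_prod_nat

theorem qProd_eq_mul {m : ℕ} (hm : 0 < m) (s : ℕ) :
    qProd s m = (1 - X ^ s) * qProd (s + m) m := by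
  have h : (fun i : ℕ => (1 - X ^ (m * (i + 1) + s) : (ZMod 2)⟦X⟧)) =
      fun i => 1 - X ^ (m * i + (s + m)) := by
    funext i
    ring_nf
  rw [qProd, tprod_eq_zero_mul', h, qProd]
  · simp
  · rw [h]
    exact multipliable_one_sub_X_pow_progression hm _

theorem X_pow_dvd_qProd_sub_one {m : ℕ} (hm : 0 < m) (s : ℕ) : X ^ s ∣ qProd s m - 1 := by
  have hprod : ∀ N, (X ^ s : (ZMod 2)⟦X⟧) ∣
      ∏ i ∈ Finset.range N, (1 - X ^ (m * i + s) : (ZMod 2)⟦X⟧) - 1 := by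
    intro N
    induction N with
    | zero => simp
    | succ N ih =>
      rw [Finset.prod_range_succ, mul_sub, mul_one, sub_right_comm]
      exact dvd_sub ih (Dvd.dvd.mul_left (pow_dvd_pow _ (by omega)) _)
  rw [X_pow_dvd_iff]
  intro j hj
  have h1 := ((continuous_coeff (ZMod 2) j).tendsto _).comp ((tendsto_qProd hm s).sub_const 1)
  refine tendsto_nhds_unique h1 (tendsto_const_nhds.congr fun N => ?_)
  exact (X_pow_dvd_iff.1 (hprod N) j hj).symm

theorem qProd_sq {m : ℕ} (hm : 0 < m) (s : ℕ) : qProd s m ^ 2 = qProd (2 * s) (2 * m) := by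
  refine tendsto_nhds_unique ((tendsto_qProd hm s).pow 2)
    ((tendsto_qProd (m := 2 * m) (by omega) (2 * s)).congr fun N => ?_)
  rw [← Finset.prod_pow]
  refine Finset.prod_congr rfl fun i _ => ?_
  have h2 : (2 : (ZMod 2)⟦X⟧) = 0 := by
    rw [← map_ofNat (C (R := ZMod 2)) 2, show (OfNat.ofNat 2 : ZMod 2) = 0 from rfl, map_zero]
  rw [show 2 * m * i + 2 * s = (m * i + s) * 2 by ring, pow_mul]
  linear_combination (X ^ (m * i + s) * (1 - X ^ (m * i + s))) * h2

theorem qProd_split_two {m : ℕ} (hm : 0 < m) (s : ℕ) :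
    qProd s m = qProd s (2 * m) * qProd (s + m) (2 * m) := by
  have h2 : 0 < 2 * m := by omega
  refine tendsto_nhds_unique
    ((tendsto_qProd hm s).comp (tendsto_id.const_mul_atTop' (by norm_num : 0 < 2)))
    (((tendsto_qProd h2 s).mul (tendsto_qProd h2 (s + m))).congr fun N => ?_)
  simp only [Function.comp_apply, id]
  induction N with
  | zero => simp
  | succ N ih =>
    rw [Finset.prod_range_succ, Finset.prod_range_succ, mul_mul_mul_comm, ih, mul_add,
      Finset.prod_range_add, mul_one, Finset.prod_range_succ, Finset.prod_range_one]
    ring_nf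

theorem qProd_split_three {m : ℕ} (hm : 0 < m) (s : ℕ) :
    qProd s m = qProd s (3 * m) * qProd (s + m) (3 * m) * qProd (s + 2 * m) (3 * m) := by
  have h3 : 0 < 3 * m := by omega
  refine tendsto_nhds_unique
    ((tendsto_qProd hm s).comp (tendsto_id.const_mul_atTop' (by norm_num : 0 < 3)))
    ((((tendsto_qProd h3 s).mul (tendsto_qProd h3 (s + m))).mul
      (tendsto_qProd h3 (s + 2 * m))).congr fun N => ?_)
  simp only [Function.comp_apply, id]
  induction N with
  | zero => simp
  | succ N ih =>
    simp only [show 3 * (N + 1) = 3 * N + 1 + 1 + 1 by ring, Finset.prod_range_succ]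
    rw [← ih]
    ring

theorem qProd_one_one : qProd 1 1 = pentagonalSeries (ZMod 2) := by
  simpa [qProd] using tprod_one_sub_X_pow (ZMod 2)

theorem qProd_self_eq_expand {m : ℕ} (hm : m ≠ 0) :
    qProd m m = expand m hm (pentagonalSeries (ZMod 2)) := by
  have hc : Continuous (expand m hm (R := ZMod 2)) := by
    refine continuous_iff_continuousAt.2 fun f => ?_
    refine (tendsto_iff_coeff_tendsto _ _ _ _).2 fun d => ?_
    simp_rw [coeff_expand]
    split_ifs
    · exact (continuous_coeff (ZMod 2) _).tendsto f
    · exact tendsto_const_nhds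
  have h := (hc.tendsto _).comp (tendsto_qProd one_pos 1)
  rw [qProd_one_one] at h
  refine tendsto_nhds_unique (tendsto_qProd (Nat.pos_of_ne_zero hm) m) (h.congr fun N => ?_)
  simp only [Function.comp_apply, map_prod, map_sub, map_pow, map_one, expand_X]
  refine Finset.prod_congr rfl fun i _ => ?_
  rw [← pow_mul]
  ring_nf

end

theorem qProd_ne_zero {m s : ℕ} (hm : 0 < m) (hs : 0 < s) : qProd s m ≠ 0 := by
  intro h
  have := X_pow_dvd_qProd_sub_one hm s
  rw [h, X_pow_dvd_iff] at this
  simpa using this 0 hs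

/-- The factors with even multiples of `m` form `qProd m m ^ 2` modulo 2; cancel one `qProd m m`. -/
theorem qProd_odd_mul_self {m : ℕ} (hm : 0 < m) : qProd m (2 * m) * qProd m m = 1 := by
  have h : qProd m m = qProd m (2 * m) * qProd m m ^ 2 := by
    rw [qProd_sq hm]
    conv_lhs => rw [qProd_split_two hm, ← two_mul]
  have h0 := qProd_ne_zero hm hm
  apply mul_left_cancel₀ h0
  linear_combination -h

/-! ### The generating function as a product -/

/-- The generating function of copartitions modulo `2`. -/
noncomputable def cpSeries (a b m : ℕ) : (ZMod 2)⟦X⟧ := mk fun n => (cp a b m n : ZMod 2)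

theorem cpSeries_comm {a b m : ℕ} (ha : 0 < a) (hb : 0 < b) : cpSeries a b m = cpSeries b a m := by
  simp only [cpSeries, cp_comm ha hb]

theorem cpSeries_recurrence {a b m : ℕ} (ha : 0 < a) (hb : 0 < b) (hm : 0 < m) :
    cpSeries a b m = X ^ a * cpSeries a (b + m) m + cpSeries (a + m) b m := by
  ext n
  simp only [cpSeries, map_add, coeff_X_pow_mul', coeff_mk, cp_recurrence ha hb hm n]
  split_ifs <;> simp

theorem X_pow_dvd_cpSeries_sub_one {a b m : ℕ} (ha : 0 < a) (hb : 0 < b) :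
    X ^ (min a b) ∣ cpSeries a b m - 1 := by
  rw [X_pow_dvd_iff]
  intro j hj
  rcases eq_or_ne j 0 with rfl | h
  · rw [map_sub, cpSeries, coeff_mk, cp_zero ha hb]
    simp
  · simp [cpSeries, coeff_one, h, cp_eq_zero_of_lt h hj]

/-- Induction on the precision `n`, then on a bound for (n - a) + (n - b). In the recurrence, one
term carries `X ^ a` and needs only precision n - a; the other raises `a`, lowering the bound. Once
a, b ≥ n, every series is 1 modulo `X ^ n`. -/
theorem X_pow_dvd_cpSeries_mul_sub {m : ℕ} (hm : 0 < m) (n : ℕ) :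
    ∀ k a b : ℕ, 0 < a → 0 < b → (n - a) + (n - b) ≤ k →
      X ^ n ∣ cpSeries a b m * qProd a m * qProd b m - qProd (a + b) m := by
  induction n using Nat.strong_induction_on with
  | _ n ihn =>
  intro k
  induction k with
  | zero =>
    intro a b ha hb h
    obtain ⟨u, hu⟩ := (pow_dvd_pow X (by omega)).trans
      (X_pow_dvd_cpSeries_sub_one (m := m) ha hb) (a := (X : (ZMod 2)⟦X⟧) ^ n)
    obtain ⟨v, hv⟩ := (pow_dvd_pow X (by omega)).trans
      (X_pow_dvd_qProd_sub_one hm a) (a := (X : (ZMod 2)⟦X⟧) ^ n)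
    obtain ⟨w, hw⟩ := (pow_dvd_pow X (by omega)).trans
      (X_pow_dvd_qProd_sub_one hm b) (a := (X : (ZMod 2)⟦X⟧) ^ n)
    obtain ⟨z, hz⟩ := (pow_dvd_pow X (by omega)).trans
      (X_pow_dvd_qProd_sub_one hm (a + b)) (a := (X : (ZMod 2)⟦X⟧) ^ n)
    refine ⟨u * qProd a m * qProd b m + v * qProd b m + w - z, ?_⟩
    linear_combination qProd a m * qProd b m * hu + qProd b m * hv + hw - hz
  | succ k ihk =>
    have key : ∀ a b : ℕ, 0 < a → 0 < b → (n - a) + (n - b) ≤ k + 1 → a < n →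
        X ^ n ∣ cpSeries a b m * qProd a m * qProd b m - qProd (a + b) m := by
      intro a b ha hb h han
      obtain ⟨u, hu⟩ := ihk (a + m) b (by omega) hb (by omega)
      obtain ⟨v, hv⟩ := ihn (n - a) (by omega) _ a (b + m) ha (by omega) le_rfl
      have hX : (X : (ZMod 2)⟦X⟧) ^ n = X ^ a * X ^ (n - a) := by
        rw [← pow_add]
        congr 1
        omega
      rw [show a + m + b = a + b + m by ring] at hu
      rw [show a + (b + m) = a + b + m by ring] at hv
      -- The two terms recombine through (1 - X^a) + X^a (1 - X^b) = 1 - X^(a+b).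
      refine ⟨(1 - X ^ a) * u + (1 - X ^ b) * v, ?_⟩
      have e1 := cpSeries_recurrence (m := m) ha hb hm
      have e2 := qProd_eq_mul hm a
      have e3 := qProd_eq_mul hm b
      have e4 := qProd_eq_mul hm (a + b)
      rw [e1, e4]
      have e5 : X ^ a * (cpSeries a (b + m) m * qProd a m * qProd b m) =
          (1 - X ^ b) * (X ^ a * (cpSeries a (b + m) m * qProd a m * qProd (b + m) m)) := by
        rw [e3]; ring
      have e6 : cpSeries (a + m) b m * qProd a m * qProd b m =
          (1 - X ^ a) * (cpSeries (a + m) b m * qProd (a + m) m * qProd b m) := by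
        rw [e2]; ring
      rw [pow_add X a b]
      linear_combination e5 + e6 + (1 - X ^ a) * hu + (1 - X ^ b) * X ^ a * hv
        - (1 - X ^ b) * v * hX
    intro a b ha hb h
    rcases lt_or_ge a n with han | han
    · exact key a b ha hb h han
    · rcases lt_or_ge b n with hbn | hbn
      · have := key b a hb ha (by omega) hbn
        rwa [cpSeries_comm hb ha, add_comm b a, mul_right_comm] at this
      · exact ihk a b ha hb (by omega)

theorem cpSeries_mul_qProd {a b m : ℕ} (ha : 0 < a) (hb : 0 < b) (hm : 0 < m) :
    cpSeries a b m * qProd a m * qProd b m = qProd (a + b) m := by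
  rw [← sub_eq_zero]
  ext n
  exact X_pow_dvd_iff.1 (X_pow_dvd_cpSeries_mul_sub hm (n + 1) _ a b ha hb le_rfl) n (by omega)

theorem cpSeries_three_one_four : cpSeries 3 1 4 = qProd 1 1 * qProd 4 4 := by
  have h := cpSeries_mul_qProd (a := 3) (b := 1) (m := 4) (by norm_num) (by norm_num) (by norm_num)
  have h1 := qProd_odd_mul_self one_pos
  have h2 := qProd_split_two (m := 2) (by norm_num) 1
  norm_num at h h1 h2
  rw [h2] at h1
  linear_combination qProd 1 1 * h - cpSeries 3 1 4 * h1

/-- Here (q; q²) also contains the residue 3 modulo 6, which leaves an extra factor `qProd 3 6`, the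
inverse of `qProd 3 3`. -/
theorem cpSeries_five_one_six : cpSeries 5 1 6 = qProd 1 1 * qProd 3 3 := by
  have h := cpSeries_mul_qProd (a := 5) (b := 1) (m := 6) (by norm_num) (by norm_num) (by norm_num)
  have h1 := qProd_odd_mul_self one_pos
  have h3 := qProd_odd_mul_self (m := 3) (by norm_num)
  have h2 := qProd_split_three (m := 2) (by norm_num) 1
  have h4 := qProd_sq (m := 3) (by norm_num) 3
  norm_num at h h1 h2 h3 h4
  rw [h2] at h1
  rw [← h4] at h
  have h5 : cpSeries 5 1 6 = qProd 3 6 * qProd 1 1 * qProd 3 3 ^ 2 := by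
    linear_combination qProd 3 6 * qProd 1 1 * h - cpSeries 5 1 6 * h1
  linear_combination h5 + qProd 1 1 * qProd 3 3 * h3

/-! ### Quadratic forms and the congruences -/

theorem coeff_qProd_self_eq_zero {m : ℕ} (hm : m ≠ 0) {n : ℕ}
    (h : ∀ k : ℤ, n ≠ m * pentagonal k) : coeff n (qProd m m) = 0 := by
  rw [qProd_self_eq_expand hm, coeff_expand]
  split_ifs with hd
  · obtain ⟨q, rfl⟩ := hd
    rw [Nat.mul_div_cancel_left _ (Nat.pos_of_ne_zero hm)]
    refine coeff_pentagonalSeries_eq_zero _ ?_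
    rintro ⟨k, hk⟩
    exact h k (by rw [hk])
  · rfl

theorem coeff_qProd_mul_eq_zero {d : ℕ} (hd : d ≠ 0) {n : ℕ}
    (h : ∀ x y : ℤ, (24 * n + 1 + d : ℤ) ≠ x ^ 2 + d * y ^ 2) :
    coeff n (qProd 1 1 * qProd d d) = 0 := by
  rw [coeff_mul]
  refine Finset.sum_eq_zero fun p hp => ?_
  have hp' := Finset.HasAntidiagonal.mem_antidiagonal.1 hp
  by_contra hne
  obtain ⟨h1, h2⟩ := mul_ne_zero_iff.1 hne
  have h1' := mt (coeff_qProd_self_eq_zero one_ne_zero) h1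
  have h2' := mt (coeff_qProd_self_eq_zero hd) h2
  push Not at h1' h2'
  obtain ⟨i, hi⟩ := h1'
  obtain ⟨j, hj⟩ := h2'
  -- Completing the square: 24 · k(3k - 1)/2 + 1 = (6k - 1)².
  refine h (6 * i - 1) (6 * j - 1) ?_
  have ei := two_mul_natCast_pentagonal i
  have ej := two_mul_natCast_pentagonal j
  rw [← hp', hi, hj]
  push_cast
  linear_combination 12 * ei + 12 * d * ej

/-- Since -d is a nonresidue modulo 11, the form is anisotropic there, so 11 divides both x and y.
-/
theorem dvd_of_eleven_dvd {d : ℤ} (hd : (d : ZMod 11) = 3 ∨ (d : ZMod 11) = 4) {x y : ℤ}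
    (h : 11 ∣ x ^ 2 + d * y ^ 2) : 121 ∣ x ^ 2 + d * y ^ 2 := by
  have key : ∀ d x y : ZMod 11, (d = 3 ∨ d = 4) → x ^ 2 + d * y ^ 2 = 0 → x = 0 ∧ y = 0 := by
    decide
  have h' := (ZMod.intCast_zmod_eq_zero_iff_dvd _ 11).2 (by exact_mod_cast h)
  push_cast at h'
  obtain ⟨hx, hy⟩ := key d x y hd h'
  obtain ⟨u, rfl⟩ := (ZMod.intCast_zmod_eq_zero_iff_dvd x 11).1 hx
  obtain ⟨v, rfl⟩ := (ZMod.intCast_zmod_eq_zero_iff_dvd y 11).1 hy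
  exact ⟨u ^ 2 + d * v ^ 2, by push_cast; ring⟩

theorem even_cp_of_eq_qProd_mul {a b m d n : ℕ} (hd : d = 3 ∨ d = 4)
    (hs : cpSeries a b m = qProd 1 1 * qProd d d) (h1 : 11 ∣ 24 * n + 1 + d)
    (h2 : ¬ 121 ∣ 24 * n + 1 + d) : Even (cp a b m n) := by
  rw [← ZMod.natCast_eq_zero_iff_even]
  have h := coeff_qProd_mul_eq_zero (d := d) (n := n) (by omega) fun x y hxy => h2 ?_
  · rwa [← hs, cpSeries, coeff_mk] at h
  · have h1' : (11 : ℤ) ∣ 24 * n + 1 + d := by exact_mod_cast h1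
    have h2' : (121 : ℤ) ∣ 24 * n + 1 + d := by
      rw [hxy] at h1' ⊢
      refine dvd_of_eleven_dvd ?_ h1'
      rcases hd with rfl | rfl <;> simp
    exact_mod_cast h2'

theorem mainTheorem12 :
    (∀ r ∈ ({3, 14, 36, 47, 58, 69, 80, 91, 102, 113} : Finset ℕ), ∀ k : ℕ,
      Even (cp 3 1 4 (121 * k + r))) ∧
    (∀ r ∈ ({9, 31, 42, 53, 64, 75, 86, 97, 108, 119} : Finset ℕ), ∀ k : ℕ,
      Even (cp 5 1 6 (121 * k + r))) := by
  constructor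
  · intro r hr k
    simp only [Finset.mem_insert, Finset.mem_singleton] at hr
    exact even_cp_of_eq_qProd_mul (Or.inr rfl) cpSeries_three_one_four (by omega) (by omega)
  · intro r hr k
    simp only [Finset.mem_insert, Finset.mem_singleton] at hr
    exact even_cp_of_eq_qProd_mul (Or.inl rfl) cpSeries_five_one_six (by omega) (by omega)
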